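/- A network $(G,r)$ consists of an undirected multigraph $G$ (loops and parallel edges are allowed) and a function $r:E(G)\to\mathbb{R}_{>0}$; put $c(e)=1/r(e)$. It is locally finite if every vertex is incident with only finitely many edges, and connected if $G$ is non-empty and any two of its vertices are joined by a walk. A function $h:V(G)\to\mathbb{R}$ is harmonic if at every vertex $v$ $$h(v)=\Big(\sum_{e=\{v,w\}}c(e)\Big)^{-1}\sum_{e=\{v,w\}}h(w)\,c(e),$$ and its energy is $\sum_{e=\{x,y\}\in E(G)}(h(x)-h(y))^2/r(e)\in[0,\infty]$. The network $(G,r)$ is in $\mathcal{O}_{HD}$ if every harmonic function of finite energy is constant. Let $(G,r)$ be a connected locally finite network and let $S\subseteq E(G)$ be a (possibly infinite) set of edges. Let $G-S$ denote the graph obtained from $G$ by deleting the edges in $S$ and then all isolated vertices. Suppose that $G-S$ is connected and that $\sum_{e\in S}1/r(e)<\infty$. Then $(G-S,r)$ is in $\mathcal{O}_{HD}$ if and only if $(G,r)$ is in $\mathcal{O}_{HD}$. -/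

import Mathlib

open scoped Graph ENNReal

/-- A vertex is isolated if no edge (not even a loop) is incident with it. -/
def Graph.IsIsolated {α β : Type*} (G : Graph α β) (v : α) : Prop :=
  v ∈ V(G) ∧ ∀ e, ¬ G.Inc e v

/-- A multigraph is locally finite if every vertex is incident with only finitely many edges. -/
def Graph.IsLocallyFinite {α β : Type*} (G : Graph α β) : Prop :=
  ∀ v ∈ V(G), (G.incidenceSet v).Finite

/-- A multigraph is connected if it is non-empty and any two vertices are joined by a walk. -/
def Graph.IsConnected {α β : Type*} (G : Graph α β) : Prop :=
  V(G).Nonempty ∧ ∀ x ∈ V(G), ∀ y ∈ V(G), Relation.ReflTransGen G.Adj x y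

/-- A network: a multigraph (loops and parallel edges allowed) together with a positive
resistance for every edge. Values of `resistance` outside the edge set play no role. -/
structure Network (α β : Type*) where
  graph : Graph α β
  resistance : β → ℝ
  resistance_pos : ∀ e ∈ E(graph), 0 < resistance e

namespace Network

variable {α β : Type*}

/-- The conductance `c(e) = 1 / r(e)`. -/
noncomputable def conductance (N : Network α β) (e : β) : ℝ := 1 / N.resistance e

/-- The pairs `(e, w)` such that `e` is an edge with ends `v` and `w`. -/
def linksAt (N : Network α β) (v : α) : Set (β × α) := {p | N.graph.IsLink p.1 v p.2}

/-- The directed edges `(e, x, y)`: `e` is an edge with ends `x ≠ y`, directed from `x` to `y`. -/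
def directedEdges (N : Network α β) : Set (β × α × α) :=
  {d | N.graph.IsLink d.1 d.2.1 d.2.2 ∧ d.2.1 ≠ d.2.2}

/-- The function on directed edges induced by a potential `h`. Only the values of `h` on the
vertex set matter. -/
noncomputable def induced (N : Network α β) (h : α → ℝ) (d : β × α × α) : ℝ :=
  (h d.2.1 - h d.2.2) / N.resistance d.1

/-- The energy of an antisymmetric function on the directed edges, that is, the sum over all
edges `e` of `r(e) φ(e)²`. In the sum over directed edges every non-loop edge occurs
twice, once for each direction, whence the division by two. Loops carry no directed edge. -/
noncomputable def energy (N : Network α β) (φ : β × α × α → ℝ) : ℝ≥0∞ :=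
  (∑' d : N.directedEdges, ENNReal.ofReal (N.resistance d.1.1 * φ d.1 ^ 2)) / 2

/-- The mean-value property of `h` at `v`: `h v` is the average of the values of `h` at the
neighbours of `v`, weighted with the conductances. -/
def MeanValueAt (N : Network α β) (h : α → ℝ) (v : α) : Prop :=
  h v = (∑ᶠ p ∈ N.linksAt v, N.conductance p.1)⁻¹ *
    ∑ᶠ p ∈ N.linksAt v, h p.2 * N.conductance p.1

/-- `h` is harmonic if it has the mean-value property at every vertex. -/
def IsHarmonic (N : Network α β) (h : α → ℝ) : Prop :=
  ∀ v ∈ V(N.graph), N.MeanValueAt h v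

/-- The class `𝒪_HD`: every harmonic function of finite energy is constant. -/
def InOHD (N : Network α β) : Prop :=
  ∀ h : α → ℝ, N.IsHarmonic h → N.energy (N.induced h) < ∞ →
    ∀ x ∈ V(N.graph), ∀ y ∈ V(N.graph), h x = h y

/-- The network `(G - S, r)`: delete the edges in `S` and then all isolated vertices. -/
def delete (N : Network α β) (S : Set β) : Network α β where
  graph := (N.graph.deleteEdges S).deleteVerts {v | (N.graph.deleteEdges S).IsIsolated v}
  resistance := N.resistance
  resistance_pos e he := N.resistance_pos e
    ((Graph.deleteVerts_le.trans Graph.deleteEdges_le :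
      (N.graph.deleteEdges S).deleteVerts _ ≤ N.graph).edgeSet_mono he)

end Network

open Filter Topology

/-! For a connected locally finite network, being in 𝒪_HD is equivalent to a condition that visibly
survives changing edges of finite total conductance: every bounded function of finite energy is
`Approximable`.

If the condition holds (`inOHD_of_approximable`), let `h` be harmonic of finite energy. Its gradient
is orthogonal to gradients of finitely supported functions, hence by weak convergence to the
gradient of each truncation of `h`. All terms of that inner product are nonnegative, so they vanish
and `h` is constant.

Conversely (`InOHD.approximable`), project the gradient of `f` onto the closure of the gradients of
finitely supported functions. The remainder is the gradient of a harmonic function, so it is zero in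
𝒪_HD. This yields approximants, which are then made uniformly bounded.

A function bounded by `B` has energy at most `(2B)² ∑ 1/r(e)` on `S` (`tsum_edgeEnergy_le` bounds
twice this energy), so uniform bounds on values and energy transfer between `G` and `G - S`. -/

/-- A norm-bounded family in `ℓ²` that converges coordinatewise converges weakly. -/
theorem lp.tendsto_inner_of_tendsto_apply {ι κ : Type*} {l : Filter κ}
    {u : κ → lp (fun _ : ι => ℝ) 2} {w : lp (fun _ : ι => ℝ) 2} {R : ℝ}
    (hR : ∀ᶠ k in l, ‖u k‖ ≤ R) (hu : ∀ i, Tendsto (fun k => u k i) l (𝓝 (w i)))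
    (v : lp (fun _ : ι => ℝ) 2) :
    Tendsto (fun k => inner ℝ v (u k)) l (𝓝 (inner ℝ v w)) := by
  classical
  rw [Metric.tendsto_nhds]
  intro ε hε
  have hv := lp.hasSum_single (p := 2) (by norm_num) v
  set C : ℝ := |R| + ‖w‖ + 1 with hC
  have hC0 : 0 < C := by positivity
  obtain ⟨A, hA⟩ := ((Metric.tendsto_nhds.1 hv) (ε / 2 / C) (by positivity)).exists
  have hfin : Tendsto (fun k => ∑ i ∈ A, v i * (u k i - w i)) l (𝓝 0) := by
    have : Tendsto (fun k => ∑ i ∈ A, v i * (u k i - w i)) l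
        (𝓝 (∑ i ∈ A, v i * (w i - w i))) :=
      tendsto_finsetSum _ fun i _ => ((hu i).sub_const (w i)).const_mul (v i)
    simpa using this
  filter_upwards [hR, (Metric.tendsto_nhds.1 hfin) (ε / 2) (by positivity)] with k hk hk2
  set vA : lp (fun _ : ι => ℝ) 2 := ∑ i ∈ A, lp.single 2 i (v i) with hvA
  have h1 : inner ℝ vA (u k - w) = ∑ i ∈ A, v i * (u k i - w i) := by
    rw [hvA, sum_inner]
    refine Finset.sum_congr rfl fun i _ => ?_
    rw [lp.inner_single_left]
    simp [mul_comm]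
  have h2 : |inner ℝ (v - vA) (u k - w)| ≤ ε / 2 := by
    refine (abs_real_inner_le_norm _ _).trans ?_
    have h3 : ‖v - vA‖ ≤ ε / 2 / C := by
      rw [dist_comm, dist_eq_norm] at hA
      exact hA.le
    have h4 : ‖u k - w‖ ≤ C := by
      refine (norm_sub_le _ _).trans ?_
      have := le_abs_self R
      linarith
    calc ‖v - vA‖ * ‖u k - w‖ ≤ ε / 2 / C * C := by gcongr
      _ = ε / 2 := by field_simp
  have h5 : inner ℝ v (u k) - inner ℝ v w
      = inner ℝ (v - vA) (u k - w) + ∑ i ∈ A, v i * (u k i - w i) := by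
    rw [← h1, ← inner_add_left, sub_add_cancel, inner_sub_right]
  rw [Real.dist_eq, h5]
  rw [Real.dist_eq, sub_zero] at hk2
  calc _ ≤ _ := abs_add_le _ _
    _ < ε := by linarith

/-! ### Gradients in `ℓ²` and the Dirichlet energy. -/

namespace Network

variable {α β : Type*}

/-- The potential differences of `h` along the directed edges, divided by the square root of the
resistance. Its square sum is twice the energy of `h`. -/
noncomputable def grad (N : Network α β) (h : α → ℝ) (d : N.directedEdges) : ℝ :=
  (h d.1.2.1 - h d.1.2.2) / √(N.resistance d.1.1)

/-- Twice the energy of `h`. -/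
noncomputable def dirichlet (N : Network α β) (h : α → ℝ) : ℝ≥0∞ :=
  ∑' d : N.directedEdges, ENNReal.ofReal (N.grad h d ^ 2)

variable {N : Network α β}

theorem resistance_pos_of_mem (d : N.directedEdges) : 0 < N.resistance d.1.1 :=
  N.resistance_pos _ d.2.1.edge_mem

theorem energy_induced (h : α → ℝ) : N.energy (N.induced h) = N.dirichlet h / 2 := by
  unfold energy dirichlet
  congr 1
  refine tsum_congr fun d => ?_
  have hr := resistance_pos_of_mem d
  congr 1
  rw [grad, induced, div_pow, div_pow, Real.sq_sqrt hr.le]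
  field_simp

theorem energy_induced_lt_top (h : α → ℝ) :
    N.energy (N.induced h) < ∞ ↔ N.dirichlet h < ∞ := by
  rw [energy_induced, lt_top_iff_ne_top, lt_top_iff_ne_top, Ne, Ne, ENNReal.div_eq_top]
  simp

theorem grad_sub (f g : α → ℝ) : N.grad (f - g) = N.grad f - N.grad g := by
  ext d; simp only [grad, Pi.sub_apply]; ring

theorem grad_add (f g : α → ℝ) : N.grad (f + g) = N.grad f + N.grad g := by
  ext d; simp only [grad, Pi.add_apply]; ring

theorem grad_smul (c : ℝ) (f : α → ℝ) : N.grad (c • f) = c • N.grad f := by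
  ext d; simp only [grad, Pi.smul_apply, smul_eq_mul]; ring

theorem dirichlet_mono {f g : α → ℝ} (h : ∀ x y, |f x - f y| ≤ |g x - g y|) :
    N.dirichlet f ≤ N.dirichlet g := by
  refine ENNReal.tsum_le_tsum fun d => ENNReal.ofReal_le_ofReal ?_
  rw [sq_le_sq, grad, grad, abs_div, abs_div]
  exact div_le_div_of_nonneg_right (h _ _) (abs_nonneg _)

theorem dirichlet_le_of_le_add {f g k : α → ℝ}
    (h : ∀ x y, |f x - f y| ≤ |g x - g y| + |k x - k y|) :
    N.dirichlet f ≤ 2 * (N.dirichlet g + N.dirichlet k) := by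
  unfold dirichlet
  rw [← ENNReal.tsum_add, ← ENNReal.tsum_mul_left]
  refine ENNReal.tsum_le_tsum fun d => ?_
  rw [← ENNReal.ofReal_add (sq_nonneg _) (sq_nonneg _), ← ENNReal.ofReal_ofNat 2,
    ← ENNReal.ofReal_mul (by norm_num)]
  refine ENNReal.ofReal_le_ofReal ?_
  have h1 : |N.grad f d| ≤ |N.grad g d| + |N.grad k d| := by
    rw [grad, grad, grad, abs_div, abs_div, abs_div, ← add_div]
    gcongr
    exact h _ _
  rw [← sq_abs, ← sq_abs (N.grad g d), ← sq_abs (N.grad k d)]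
  nlinarith [abs_nonneg (N.grad f d), sq_nonneg (|N.grad g d| - |N.grad k d|)]

theorem memℓp_grad_iff {h : α → ℝ} : Memℓp (N.grad h) 2 ↔ N.dirichlet h < ∞ := by
  rw [memℓp_gen_iff (by norm_num)]
  have : (fun d => ‖N.grad h d‖ ^ (2 : ℝ≥0∞).toReal) = fun d => N.grad h d ^ 2 := by
    ext d; simp
  rw [this, dirichlet, lt_top_iff_ne_top]
  constructor
  · exact fun hs => hs.tsum_ofReal_ne_top
  · intro hs
    refine (ENNReal.summable_toReal hs).congr fun d => ?_
    rw [ENNReal.toReal_ofReal (sq_nonneg _)]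

/-- The gradient of a function of finite energy as an element of `ℓ²`. -/
noncomputable def gradLp (h : α → ℝ) (hh : N.dirichlet h < ∞) :
    lp (fun _ : N.directedEdges => ℝ) 2 :=
  ⟨N.grad h, memℓp_grad_iff.2 hh⟩

@[simp] theorem gradLp_apply (h : α → ℝ) (hh : N.dirichlet h < ∞) (d : N.directedEdges) :
    gradLp h hh d = N.grad h d := rfl

theorem dirichlet_eq_norm_sq (h : α → ℝ) (hh : N.dirichlet h < ∞) :
    N.dirichlet h = ENNReal.ofReal (‖gradLp h hh‖ ^ 2) := by
  rw [← real_inner_self_eq_norm_sq, lp.inner_eq_tsum, ENNReal.ofReal_tsum_of_nonneg]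
  · refine tsum_congr fun d => ?_
    simp [pow_two]
  · intro d
    exact real_inner_self_nonneg
  · exact lp.summable_inner _ _

/-! ### Divergence, and harmonicity as orthogonality. -/

/-- The directed edges starting at `v`. -/
def outEdges (N : Network α β) (v : α) : Set N.directedEdges := {d | d.1.2.1 = v}

theorem finite_linksAt (hfin : N.graph.IsLocallyFinite) {v : α} (hv : v ∈ V(N.graph)) :
    (N.linksAt v).Finite := by
  refine Set.Finite.of_finite_image (f := Prod.fst) ((hfin v hv).subset ?_) ?_
  · rintro _ ⟨p, hp, rfl⟩
    exact ⟨p.2, hp⟩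
  · rintro ⟨e, x⟩ hp ⟨e', y⟩ hq (rfl : e = e')
    exact Prod.ext rfl (Graph.IsLink.right_unique hp hq)

theorem finite_outEdges (hfin : N.graph.IsLocallyFinite) (v : α) : (N.outEdges v).Finite := by
  by_cases hv : v ∈ V(N.graph)
  · refine Set.Finite.of_finite_image (f := fun d => (d.1.1, d.1.2.2))
      ((finite_linksAt hfin hv).subset ?_) ?_
    · rintro _ ⟨d, rfl, rfl⟩
      exact d.2.1
    · rintro ⟨⟨e, x, y⟩, hd⟩ (rfl : x = v) ⟨⟨e', x', y'⟩, hd'⟩ (rfl : x' = x) h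
      simp only [Prod.mk.injEq] at h
      obtain ⟨rfl, rfl⟩ := h
      rfl
  · convert Set.finite_empty
    refine Set.eq_empty_of_forall_notMem fun d hd => hv ?_
    rw [← show d.1.2.1 = v from hd]
    exact d.2.1.left_mem

/-- Reversal of directed edges. -/
def reverse (N : Network α β) : N.directedEdges ≃ N.directedEdges where
  toFun d := ⟨(d.1.1, d.1.2.2, d.1.2.1), d.2.1.symm, d.2.2.symm⟩
  invFun d := ⟨(d.1.1, d.1.2.2, d.1.2.1), d.2.1.symm, d.2.2.symm⟩
  left_inv _ := rfl
  right_inv _ := rfl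

theorem dirichlet_finsupp_lt_top (hfin : N.graph.IsLocallyFinite) (g : α →₀ ℝ) :
    N.dirichlet g < ∞ := by
  rw [← memℓp_grad_iff]
  have hs : (⋃ v ∈ g.support, (N.outEdges v ∪ N.reverse ⁻¹' N.outEdges v)).Finite := by
    refine g.support.finite_toSet.biUnion fun v _ => (finite_outEdges hfin v).union ?_
    exact (finite_outEdges hfin v).preimage N.reverse.injective.injOn
  rw [memℓp_gen_iff (by norm_num)]
  refine summable_of_hasFiniteSupport (hs.subset fun d hd => ?_)
  by_contra hcon
  simp only [Set.mem_iUnion, not_exists, Set.mem_union, not_or, Set.mem_preimage] at hcon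
  refine hd ?_
  have h1 : g d.1.2.1 = 0 := by
    by_contra h0
    exact (hcon _ (Finsupp.mem_support_iff.2 h0)).1 rfl
  have h2 : g d.1.2.2 = 0 := by
    by_contra h0
    exact (hcon _ (Finsupp.mem_support_iff.2 h0)).2 rfl
  simp [grad, h1, h2]

/-- The gradient as a linear map from the finitely supported functions to `ℓ²`. -/
noncomputable def gradFinsupp (hfin : N.graph.IsLocallyFinite) :
    (α →₀ ℝ) →ₗ[ℝ] lp (fun _ : N.directedEdges => ℝ) 2 where
  toFun g := gradLp g (dirichlet_finsupp_lt_top hfin g)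
  map_add' f g := by
    ext d
    exact congrFun (grad_add (N := N) f g) d
  map_smul' c g := by
    ext d
    exact congrFun (grad_smul (N := N) c g) d

@[simp] theorem gradFinsupp_apply (hfin : N.graph.IsLocallyFinite) (g : α →₀ ℝ)
    (d : N.directedEdges) : gradFinsupp hfin g d = N.grad g d := rfl

/-- The divergence of the flow induced by `h` at a vertex `v`, as an inner product. -/
theorem inner_gradLp_single (hfin : N.graph.IsLocallyFinite) {h : α → ℝ}
    (hh : N.dirichlet h < ∞) {v : α} (hv : v ∈ V(N.graph)) :
    inner ℝ (gradLp h hh) (gradFinsupp hfin (Finsupp.single v 1))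
      = 2 * ∑ᶠ p ∈ N.linksAt v, (h v - h p.2) * N.conductance p.1 := by
  classical
  have hfo := finite_outEdges hfin v
  -- A directed edge meets `v` at its tail or at its head; reversal exchanges the two cases, which
  -- produces the factor 2.
  let φ : N.directedEdges → ℝ := fun d =>
    if d.1.2.1 = v then (h v - h d.1.2.2) * N.conductance d.1.1 else 0
  have hφs : Summable φ := by
    refine summable_of_hasFiniteSupport (hfo.subset fun d hd => ?_)
    by_contra hc
    exact hd (if_neg hc)
  have h1 : ∀ d, inner ℝ (gradLp h hh d) (gradFinsupp hfin (Finsupp.single v 1) d)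
      = φ d + φ (N.reverse d) := by
    rintro ⟨⟨e, x, y⟩, hd⟩
    have hr : 0 < N.resistance e := N.resistance_pos _ hd.1.edge_mem
    have hne : x ≠ y := hd.2
    simp only [gradLp_apply, gradFinsupp_apply, grad, φ, reverse, Equiv.coe_fn_mk, conductance,
      Finsupp.single_apply, RCLike.inner_apply, conj_trivial]
    rw [div_mul_div_comm, Real.mul_self_sqrt hr.le]
    by_cases hx : x = v
    · have hy : y ≠ v := fun hy => hne (hx.trans hy.symm)
      subst hx
      simp [hne, hy]
      ring
    · by_cases hy : y = v
      · subst hy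
        simp [hne, hne.symm]
        ring
      · simp [hx, hy, Ne.symm hx, Ne.symm hy]
  rw [lp.inner_eq_tsum, tsum_congr h1, Summable.tsum_add (g := fun d => φ (N.reverse d)) hφs (N.reverse.summable_iff.2 hφs),
    N.reverse.tsum_eq φ, ← two_mul]
  congr 1
  rw [tsum_eq_finsum (hfo.subset fun d hd => by
    by_contra hc
    exact hd (if_neg hc))]
  have hout : (fun d : N.directedEdges => (d.1.1, d.1.2.2)) '' N.outEdges v
      = N.linksAt v ∩ {p | p.2 ≠ v} := by
    ext ⟨e, y⟩
    constructor
    · rintro ⟨⟨⟨e, x, y⟩, hd⟩, rfl, heq⟩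
      cases heq
      exact ⟨hd.1, hd.2.symm⟩
    · rintro ⟨h1, h2⟩
      exact ⟨⟨(e, v, y), h1, Ne.symm h2⟩, rfl, rfl⟩
  have hinj : Set.InjOn (fun d : N.directedEdges => (d.1.1, d.1.2.2)) (N.outEdges v) := by
    rintro ⟨⟨e, x, y⟩, hd⟩ (rfl : x = v) ⟨⟨e', x', y'⟩, hd'⟩ (rfl : x' = x) h
    simp only [Prod.mk.injEq] at h
    obtain ⟨rfl, rfl⟩ := h
    rfl
  have hleft : ∑ᶠ d, φ d = ∑ᶠ d ∈ N.outEdges v, φ d := by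
    refine finsum_congr fun d => ?_
    by_cases hd : d ∈ N.outEdges v
    · simp [hd]
    · have hd' : d.1.2.1 ≠ v := hd
      simp [hd, φ, hd']
  -- Loops at `v` are not directed edges, but their terms `h v - h v` vanish.
  have hright : ∑ᶠ p ∈ N.linksAt v, (h v - h p.2) * N.conductance p.1
      = ∑ᶠ p ∈ N.linksAt v ∩ {p | p.2 ≠ v}, (h v - h p.2) * N.conductance p.1 := by
    refine finsum_congr fun p => ?_
    by_cases hp : p.2 = v
    · simp [hp]
    · simp [hp]
  rw [hleft, hright, ← hout, finsum_mem_image hinj]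
  exact finsum_mem_congr rfl fun d hd => if_pos hd

theorem finsum_linksAt_sub (hfin : N.graph.IsLocallyFinite) (h : α → ℝ) {v : α}
    (hv : v ∈ V(N.graph)) :
    ∑ᶠ p ∈ N.linksAt v, (h v - h p.2) * N.conductance p.1
      = h v * (∑ᶠ p ∈ N.linksAt v, N.conductance p.1)
        - ∑ᶠ p ∈ N.linksAt v, h p.2 * N.conductance p.1 := by
  have hf := finite_linksAt hfin hv
  simp only [finsum_mem_eq_finite_toFinset_sum _ hf, sub_mul, Finset.sum_sub_distrib,
    Finset.mul_sum]

theorem conductance_sum_pos (hfin : N.graph.IsLocallyFinite) {v : α}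
    (hne : (N.linksAt v).Nonempty) : 0 < ∑ᶠ p ∈ N.linksAt v, N.conductance p.1 := by
  have hf := finite_linksAt hfin hne.some_mem.left_mem
  rw [finsum_mem_eq_finite_toFinset_sum _ hf]
  refine Finset.sum_pos (fun p hp => ?_) (by simpa using hne)
  have : N.graph.IsLink p.1 v p.2 := hf.mem_toFinset.1 hp
  exact one_div_pos.2 (N.resistance_pos _ this.edge_mem)

theorem meanValueAt_iff (hfin : N.graph.IsLocallyFinite) (h : α → ℝ) {v : α}
    (hne : (N.linksAt v).Nonempty) :
    N.MeanValueAt h v ↔ ∑ᶠ p ∈ N.linksAt v, (h v - h p.2) * N.conductance p.1 = 0 := by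
  rw [finsum_linksAt_sub hfin h hne.some_mem.left_mem, MeanValueAt,
    eq_inv_mul_iff_mul_eq₀ (conductance_sum_pos hfin hne).ne', sub_eq_zero, mul_comm]

/-- Harmonic functions of finite energy are orthogonal to finitely supported functions. -/
theorem IsHarmonic.inner_gradFinsupp (hfin : N.graph.IsLocallyFinite) {h : α → ℝ}
    (hharm : N.IsHarmonic h) (hh : N.dirichlet h < ∞) (g : α →₀ ℝ) :
    inner ℝ (gradLp h hh) (gradFinsupp hfin g) = 0 := by
  induction g using Finsupp.induction_linear with
  | zero => simp
  | add f g hf hg => rw [map_add, inner_add_right, hf, hg, add_zero]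
  | single v a =>
    have : Finsupp.single v a = a • Finsupp.single v (1 : ℝ) := by simp
    rw [this, map_smul, inner_smul_right]
    by_cases hv : v ∈ V(N.graph)
    · rw [inner_gradLp_single hfin hh hv]
      rcases (N.linksAt v).eq_empty_or_nonempty with he | hne
      · simp [he]
      · rw [(meanValueAt_iff hfin h hne).1 (hharm v hv)]
        simp
    · have : gradFinsupp hfin (Finsupp.single v (1 : ℝ)) = 0 := by
        ext d
        have h1 : d.1.2.1 ≠ v := fun h => hv (h ▸ d.2.1.left_mem)
        have h2 : d.1.2.2 ≠ v := fun h => hv (h ▸ d.2.1.right_mem)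
        simp [grad, h1, h2]
      rw [this]; simp

end Network

/-! ### The approximation property implies 𝒪_HD. -/

namespace Network

variable {α β : Type*} {N : Network α β}

/-- The truncation of a real number to the interval `[-B, B]`. -/
noncomputable def clip (B t : ℝ) : ℝ := max (-B) (min B t)

theorem abs_clip_sub_clip_le (B s t : ℝ) : |clip B s - clip B t| ≤ |s - t| :=
  (abs_max_sub_max_le_max _ _ _ _).trans (by
    simpa using (abs_min_sub_min_le_max B s B t))

theorem abs_clip_le {B : ℝ} (hB : 0 ≤ B) (t : ℝ) : |clip B t| ≤ B :=
  abs_le.2 ⟨le_max_left _ _, max_le (by linarith) (min_le_left _ _)⟩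

theorem clip_of_abs_le {B t : ℝ} (h : |t| ≤ B) : clip B t = t := by
  rw [clip, min_eq_right (abs_le.1 h).2, max_eq_right (abs_le.1 h).1]

theorem clip_mono (B : ℝ) : Monotone (clip B) := fun _ _ h =>
  max_le_max le_rfl (min_le_min le_rfl h)

theorem continuous_clip (B : ℝ) : Continuous (clip B) := by
  unfold clip; fun_prop

theorem clip_zero {B : ℝ} (hB : 0 ≤ B) : clip B 0 = 0 := clip_of_abs_le (by simpa using hB)

theorem sub_mul_clip_sub_clip_nonneg (B s t : ℝ) : 0 ≤ (s - t) * (clip B s - clip B t) := by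
  rcases le_total s t with h | h
  · exact mul_nonneg_of_nonpos_of_nonpos (sub_nonpos.2 h) (sub_nonpos.2 (clip_mono B h))
  · exact mul_nonneg (sub_nonneg.2 h) (sub_nonneg.2 (clip_mono B h))

/-- Up to an additive constant, `f` is a pointwise limit of finitely supported functions that are
uniformly bounded and have uniformly bounded energy. -/
def Approximable (N : Network α β) (f : α → ℝ) : Prop :=
  ∃ (c B : ℝ) (K : ℝ≥0∞) (l : Filter (α →₀ ℝ)), K < ∞ ∧ l.NeBot ∧
    (∀ᶠ g : α →₀ ℝ in l, (∀ x, |g x| ≤ B) ∧ N.dirichlet g ≤ K) ∧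
    ∀ x ∈ V(N.graph), Tendsto (fun g : α →₀ ℝ => g x) l (𝓝 (f x - c))

theorem apply_eq_of_grad_eq_zero (hconn : N.graph.IsConnected) {h : α → ℝ}
    (hd : ∀ d, N.grad h d = 0) {x y : α} (hx : x ∈ V(N.graph)) (hy : y ∈ V(N.graph)) :
    h x = h y := by
  induction hconn.2 x hx y hy with
  | refl => rfl
  | @tail a b _ hab ih =>
    obtain ⟨e, he⟩ := hab
    rw [ih he.left_mem]
    by_cases hne : a = b
    · rw [hne]
    have h0 := hd ⟨(e, a, b), he, hne⟩
    have hr : 0 < N.resistance e := N.resistance_pos _ he.edge_mem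
    rw [grad, div_eq_zero_iff, or_iff_left (Real.sqrt_pos.2 hr).ne'] at h0
    exact sub_eq_zero.1 h0

theorem grad_tendsto {κ : Type*} {l : Filter κ} {g : κ → α → ℝ} {f : α → ℝ}
    {c : κ → ℝ} (h : ∀ x ∈ V(N.graph), Tendsto (fun k => g k x - c k) l (𝓝 (f x)))
    (d : N.directedEdges) : Tendsto (fun k => N.grad (g k) d) l (𝓝 (N.grad f d)) := by
  refine (((h _ d.2.1.left_mem).sub (h _ d.2.1.right_mem)).div_const
    (√(N.resistance d.1.1))).congr fun k => ?_
  rw [grad]; ring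

theorem norm_gradLp_le {h : α → ℝ} (hh : N.dirichlet h < ∞) {K : ℝ≥0∞} (hK : K < ∞)
    (hle : N.dirichlet h ≤ K) : ‖gradLp h hh‖ ≤ √K.toReal := by
  rw [dirichlet_eq_norm_sq h hh, ENNReal.ofReal_le_iff_le_toReal hK.ne] at hle
  exact Real.le_sqrt_of_sq_le hle

theorem inOHD_of_approximable (hconn : N.graph.IsConnected) (hfin : N.graph.IsLocallyFinite)
    (H : ∀ (f : α → ℝ) (B : ℝ), (∀ x, |f x| ≤ B) → N.dirichlet f < ∞ → N.Approximable f) :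
    N.InOHD := by
  intro h hharm hen x hx y hy
  rw [energy_induced_lt_top] at hen
  refine apply_eq_of_grad_eq_zero hconn (fun d => ?_) hx hy
  -- The truncation level depends on `d`: it leaves both ends of `d` untouched, so the term of `d`
  -- is the square of `N.grad h d`.
  set B := max |h d.1.2.1| |h d.1.2.2| with hB
  have hB0 : 0 ≤ B := (abs_nonneg _).trans (le_max_left _ _)
  set f : α → ℝ := fun z => clip B (h z) with hf
  have hfE : N.dirichlet f < ∞ :=
    (dirichlet_mono fun _ _ => abs_clip_sub_clip_le _ _ _).trans_lt hen
  obtain ⟨c, _, K, l, hK, hl, hev, hlim⟩ := H f B (fun z => abs_clip_le hB0 _) hfE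
  have hT : Tendsto (fun g => inner ℝ (gradLp h hen) (gradFinsupp hfin g)) l
      (𝓝 (inner ℝ (gradLp h hen) (gradLp f hfE))) := by
    refine lp.tendsto_inner_of_tendsto_apply (R := √K.toReal) ?_ (fun i => ?_) _
    · filter_upwards [hev] with g hg
      exact norm_gradLp_le (dirichlet_finsupp_lt_top hfin g) hK hg.2
    · refine grad_tendsto (g := fun g : α →₀ ℝ => g) (c := fun _ => -c) (fun z hz => ?_) i
      simpa using (hlim z hz).sub_const (-c)
  have h0 : inner ℝ (gradLp h hen) (gradLp f hfE) = 0 := by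
    refine tendsto_nhds_unique hT ?_
    simp only [hharm.inner_gradFinsupp hfin hen]
    exact tendsto_const_nhds
  rw [lp.inner_eq_tsum] at h0
  have hnn : ∀ i, 0 ≤ inner ℝ (gradLp h hen i) (gradLp f hfE i) := by
    intro i
    have := sub_mul_clip_sub_clip_nonneg B (h i.1.2.1) (h i.1.2.2)
    simp only [gradLp_apply, grad, RCLike.inner_apply, conj_trivial, hf]
    rw [div_mul_div_comm, mul_comm (clip B _ - _)]
    positivity
  have hz := (hasSum_zero_iff_of_nonneg hnn).1 (h0 ▸ (lp.summable_inner _ _).hasSum)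
  have hzd := congrFun hz d
  have hgf : N.grad f d = N.grad h d := by
    simp only [grad, hf]
    rw [clip_of_abs_le (le_max_left _ _), clip_of_abs_le (le_max_right _ _)]
  simpa [hgf] using hzd

/-! ### 𝒪_HD implies the approximation property. -/

/-- At a vertex without links the mean-value formula reads `h v = 0`, which is not the
zero-divergence equation. A directed edge supplies a second vertex, and connectedness then excludes
this case. -/
theorem linksAt_nonempty (hconn : N.graph.IsConnected) (d : N.directedEdges) {v : α}
    (hv : v ∈ V(N.graph)) : (N.linksAt v).Nonempty := by
  obtain ⟨w, hw, hne⟩ : ∃ w ∈ V(N.graph), v ≠ w := by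
    by_cases h : v = d.1.2.1
    · exact ⟨_, d.2.1.right_mem, h ▸ d.2.2⟩
    · exact ⟨_, d.2.1.left_mem, h⟩
  rcases Relation.ReflTransGen.cases_head (hconn.2 v hv w hw) with h | ⟨u, ⟨e, he⟩, -⟩
  · exact (hne h).elim
  · exact ⟨(e, u), he⟩

/-- In a network in `𝒪_HD`, a gradient orthogonal to the gradients of all finitely supported
functions vanishes. -/
theorem InOHD.grad_eq_zero (hconn : N.graph.IsConnected) (hfin : N.graph.IsLocallyFinite)
    (hN : N.InOHD) {h : α → ℝ} (hh : N.dirichlet h < ∞)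
    (horth : ∀ g, inner ℝ (gradLp h hh) (gradFinsupp hfin g) = 0) (d : N.directedEdges) :
    N.grad h d = 0 := by
  have hharm : N.IsHarmonic h := by
    intro v hv
    rw [meanValueAt_iff hfin h (linksAt_nonempty hconn d hv)]
    have := horth (Finsupp.single v 1)
    rw [inner_gradLp_single hfin hh hv] at this
    simpa using this
  have := hN h hharm ((energy_induced_lt_top h).2 hh) _ d.2.1.left_mem _ d.2.1.right_mem
  simp [grad, this]

/-- Convergence of the gradients implies convergence of the potentials, once these are
normalized at a vertex. -/
theorem exists_tendsto_sub (hconn : N.graph.IsConnected) {κ : Type*} {l : Filter κ}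
    {g : κ → α → ℝ} {w : N.directedEdges → ℝ}
    (h : ∀ d, Tendsto (fun k => N.grad (g k) d) l (𝓝 (w d))) {o : α} (ho : o ∈ V(N.graph)) :
    ∃ f : α → ℝ, ∀ x ∈ V(N.graph), Tendsto (fun k => g k x - g k o) l (𝓝 (f x)) := by
  have key : ∀ x ∈ V(N.graph), ∃ a : ℝ, Tendsto (fun k => g k x - g k o) l (𝓝 a) := by
    intro x hx
    induction hconn.2 o ho x hx with
    | refl => exact ⟨0, by simpa using tendsto_const_nhds⟩
    | @tail a b _ hab ih =>
      obtain ⟨e, he⟩ := hab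
      obtain ⟨s, hs⟩ := ih he.left_mem
      by_cases hne : a = b
      · exact ⟨s, hne ▸ hs⟩
      have hr : 0 < N.resistance e := N.resistance_pos _ he.edge_mem
      have hr' := (Real.sqrt_pos.2 hr).ne'
      refine ⟨s - w ⟨(e, a, b), he, hne⟩ * √(N.resistance e),
        (hs.sub ((h ⟨(e, a, b), he, hne⟩).mul_const (√(N.resistance e)))).congr fun k => ?_⟩
      simp only [grad]
      field_simp
      ring
  choose! f hf using key
  exact ⟨f, hf⟩

/-- Orthogonal projection splits the gradient of `f` into a limit of finitely supported gradients
and a harmonic part, and the latter vanishes. Gradients determine potentials only up to constants,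
hence the normalization at `o`. -/
theorem InOHD.exists_seq (hconn : N.graph.IsConnected) (hfin : N.graph.IsLocallyFinite)
    (hN : N.InOHD) {f : α → ℝ} (hf : N.dirichlet f < ∞) {o : α} (ho : o ∈ V(N.graph)) :
    ∃ (g : ℕ → α →₀ ℝ) (K : ℝ≥0∞), K < ∞ ∧ (∀ n, N.dirichlet (g n) ≤ K) ∧
      ∀ x ∈ V(N.graph), Tendsto (fun n => g n x - g n o) atTop (𝓝 (f x - f o)) := by
  set W := (LinearMap.range (gradFinsupp hfin)).topologicalClosure with hW
  have : CompleteSpace W :=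
    (Submodule.isClosed_topologicalClosure _).completeSpace_coe
  set F := gradLp f hf with hF
  set w := W.starProjection F with hw
  have hwW : w ∈ W := Submodule.starProjection_apply_mem _ _
  have hworth : F - w ∈ Wᗮ := Submodule.sub_starProjection_mem_orthogonal _
  rw [hW, ← SetLike.mem_coe, Submodule.topologicalClosure_coe, mem_closure_iff_seq_limit] at hwW
  obtain ⟨u, hu, hulim⟩ := hwW
  choose g hg using hu
  have hlim : ∀ d, Tendsto (fun n => N.grad (g n) d) atTop (𝓝 (w d)) := by
    intro d
    have := ((lp.evalCLM ℝ (fun _ : N.directedEdges => ℝ) 2 d).continuous.tendsto w).comp hulim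
    refine this.congr fun n => ?_
    rw [Function.comp_apply, ← hg n]
    rfl
  -- The projection `w` is itself a gradient, because limits of gradients are gradients on a
  -- connected network.
  obtain ⟨k, hk⟩ := exists_tendsto_sub hconn hlim ho
  have hkw : ∀ d, N.grad k d = w d := fun d =>
    tendsto_nhds_unique (grad_tendsto (c := fun n => g n o) hk d) (hlim d)
  have hgrad : N.grad (f - k) = (F - w : lp (fun _ : N.directedEdges => ℝ) 2) := by
    ext d
    rw [grad_sub, Pi.sub_apply, hkw]
    rfl
  have hfk : N.dirichlet (f - k) < ∞ := by
    rw [← memℓp_grad_iff, hgrad]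
    exact lp.memℓp _
  have hfkLp : gradLp (f - k) hfk = F - w := lp.ext hgrad
  have hzero : ∀ d, N.grad (f - k) d = 0 := by
    refine hN.grad_eq_zero hconn hfin hfk fun φ => ?_
    rw [hfkLp, real_inner_comm]
    exact (Submodule.mem_orthogonal W _).1 hworth _
      (Submodule.le_topologicalClosure _ (LinearMap.mem_range_self _ φ))
  obtain ⟨R, hR⟩ := hulim.norm.bddAbove_range
  refine ⟨g, ENNReal.ofReal (R ^ 2), ENNReal.ofReal_lt_top, fun n => ?_, fun x hx => ?_⟩
  · rw [dirichlet_eq_norm_sq _ (dirichlet_finsupp_lt_top hfin (g n))]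
    have hn : ‖gradFinsupp hfin (g n)‖ ≤ R := by
      rw [hg n]
      exact hR ⟨n, rfl⟩
    exact ENNReal.ofReal_le_ofReal (pow_le_pow_left₀ (norm_nonneg _) hn 2)
  · have hko : k o = 0 := tendsto_nhds_unique (hk o ho) (by simp)
    have := apply_eq_of_grad_eq_zero hconn hzero hx ho
    simp only [Pi.sub_apply, hko, sub_zero] at this
    rw [← this, sub_sub_cancel]
    exact hk x hx

theorem InOHD.approximable (hconn : N.graph.IsConnected) (hfin : N.graph.IsLocallyFinite)
    (hN : N.InOHD) {f : α → ℝ} {B : ℝ} (hB : ∀ x, |f x| ≤ B) (hf : N.dirichlet f < ∞) :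
    N.Approximable f := by
  obtain ⟨o, ho⟩ := hconn.1
  obtain ⟨g, K, hK, hgK, hlim⟩ := hN.exists_seq hconn hfin hf ho
  -- If `|g n o|` tends to infinity, the quotients `g n x / g n o` tend to 1 and give cutoff
  -- functions to multiply `f` by. Otherwise `g n o` converges along a subsequence, and there `g n`
  -- itself converges to `f` minus a constant.
  by_cases hT : Tendsto (fun n => |g n o|) atTop atTop
  · set φ : ℕ → α → ℝ := fun n x => clip 1 (g n x / g n o) with hφ
    have hsupp : ∀ n x, φ n x * f x ≠ 0 → x ∈ (g n).support := by
      intro n x hx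
      rw [Finsupp.mem_support_iff]
      intro h0
      simp [φ, h0, clip_zero] at hx
    refine ⟨0, B, 2 * (N.dirichlet f + K),
      map (fun n => Finsupp.onFinset (g n).support (fun x => φ n x * f x) (hsupp n)) atTop,
      ENNReal.mul_lt_top (by simp) (ENNReal.add_lt_top.2 ⟨hf, hK⟩), inferInstance, ?_, ?_⟩
    · rw [eventually_map]
      -- Once `|g n o| ≥ B`, the factor `|f y|` cancels the denominator in the differences of `φ n`.
      filter_upwards [hT.eventually_ge_atTop B, hT.eventually_gt_atTop 0] with n hn hn0
      have hφ1 : ∀ x, |φ n x| ≤ 1 := fun x => abs_clip_le zero_le_one _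
      refine ⟨fun x => ?_, ?_⟩
      · rw [Finsupp.onFinset_apply, abs_mul]
        nlinarith [hφ1 x, hB x, abs_nonneg (f x), abs_nonneg (φ n x)]
      · refine (dirichlet_le_of_le_add (g := f) (k := g n) fun x y => ?_).trans
          (mul_le_mul_right (add_le_add_right (hgK n) _) _)
        simp only [Finsupp.onFinset_apply]
        have h1 : φ n x * f x - φ n y * f y = φ n x * (f x - f y) + (φ n x - φ n y) * f y := by
          ring
        rw [h1]
        refine (abs_add_le _ _).trans (add_le_add ?_ ?_)
        · rw [abs_mul]
          exact mul_le_of_le_one_left (abs_nonneg _) (hφ1 x)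
        · rw [abs_mul]
          have h2 : |φ n x - φ n y| ≤ |g n x - g n y| / |g n o| := by
            refine (abs_clip_sub_clip_le _ _ _).trans ?_
            rw [← sub_div, abs_div]
          calc |φ n x - φ n y| * |f y| ≤ |g n x - g n y| / |g n o| * |g n o| :=
                mul_le_mul h2 ((hB y).trans hn) (abs_nonneg _) (by positivity)
            _ = |g n x - g n y| := by field_simp
    · intro x hx
      rw [tendsto_map'_iff]
      simp only [Function.comp_def, Finsupp.onFinset_apply, sub_zero]
      have h1 : Tendsto (fun n => g n x / g n o) atTop (𝓝 1) := by
        have h2 : Tendsto (fun n => (g n o)⁻¹) atTop (𝓝 0) :=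
          tendsto_inv₀_cobounded.comp (tendsto_norm_atTop_iff_cobounded.1 hT)
        have h3 := ((hlim x hx).mul h2).add_const 1
        rw [mul_zero, zero_add] at h3
        refine h3.congr' ?_
        filter_upwards [hT.eventually_gt_atTop 0] with n hn
        have := abs_pos.1 hn
        field_simp
        ring
      have h4 := (((continuous_clip 1).tendsto 1).comp h1).mul_const (f x)
      rw [clip_of_abs_le (by simp), one_mul] at h4
      exact h4
  · rw [tendsto_atTop] at hT
    push Not at hT
    obtain ⟨R, hR⟩ := hT
    have hfreq : ∃ᶠ n in atTop, g n o ∈ Metric.closedBall (0 : ℝ) R := by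
      refine hR.mono fun n hn => ?_
      rw [mem_closedBall_zero_iff]
      exact hn.le
    obtain ⟨a, -, ψ, hψ, ha⟩ :=
      tendsto_subseq_of_frequently_bounded Metric.isBounded_closedBall hfreq
    have hB0 : 0 ≤ B := (abs_nonneg _).trans (hB o)
    set c := f o - a
    -- The limit `f - c` is bounded by `B + |c|` on all vertices, so clipping at this level does not
    -- change it.
    have hC0 : 0 ≤ B + |c| := by positivity
    refine ⟨c, B + |c|, K,
      map (fun n => (g (ψ n)).mapRange (clip (B + |c|)) (clip_zero hC0)) atTop, hK,
      inferInstance, ?_, ?_⟩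
    · rw [eventually_map]
      refine Eventually.of_forall fun n => ⟨fun x => ?_, ?_⟩
      · rw [Finsupp.mapRange_apply]
        exact abs_clip_le hC0 _
      · refine (dirichlet_mono fun x y => ?_).trans (hgK (ψ n))
        rw [Finsupp.mapRange_apply, Finsupp.mapRange_apply]
        exact abs_clip_sub_clip_le _ _ _
    · intro x hx
      rw [tendsto_map'_iff]
      simp only [Function.comp_def, Finsupp.mapRange_apply]
      have h1 : Tendsto (fun n => g (ψ n) x) atTop (𝓝 (f x - c)) := by
        have := ((hlim x hx).comp hψ.tendsto_atTop).add ha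
        rw [show f x - c = f x - f o + a by simp only [c]; ring]
        refine this.congr fun n => ?_
        simp
      have h2 := ((continuous_clip (B + |c|)).tendsto _).comp h1
      rwa [clip_of_abs_le ((abs_sub _ _).trans (add_le_add (hB x) le_rfl))] at h2

end Network

/-! ### Deleting edges of finite total conductance. -/

namespace Network

variable {α β : Type*} {N : Network α β} {S : Set β}

theorem delete_isLink {e : β} {x y : α} :
    (N.delete S).graph.IsLink e x y ↔ N.graph.IsLink e x y ∧ e ∉ S := by
  have hE : (N.graph.deleteEdges S).IsLink e x y ↔ N.graph.IsLink e x y ∧ e ∉ S := by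
    simp only [Graph.deleteEdges, Graph.copy]
  rw [← hE, delete, Graph.deleteVerts_isLink]
  exact ⟨fun h => h.1, fun h => ⟨h, fun hi => hi.2 e h.inc_left, fun hi => hi.2 e h.inc_right⟩⟩

theorem vertexSet_delete_subset : V((N.delete S).graph) ⊆ V(N.graph) :=
  (Graph.deleteVerts_le.trans Graph.deleteEdges_le :
    (N.graph.deleteEdges S).deleteVerts _ ≤ N.graph).vertexSet_mono

theorem isLocallyFinite_delete (hfin : N.graph.IsLocallyFinite) :
    (N.delete S).graph.IsLocallyFinite := fun v hv =>
  (hfin v (vertexSet_delete_subset hv)).subset fun _ ⟨w, hw⟩ => ⟨w, (delete_isLink.1 hw).1⟩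

/-- The square of the potential difference along `d` divided by the resistance. -/
noncomputable def edgeEnergy (N : Network α β) (h : α → ℝ) (d : β × α × α) : ℝ≥0∞ :=
  ENNReal.ofReal (((h d.2.1 - h d.2.2) / √(N.resistance d.1)) ^ 2)

theorem directedEdges_eq_union : N.directedEdges =
    (N.delete S).directedEdges ∪ (N.directedEdges ∩ {d | d.1 ∈ S}) := by
  ext d
  simp only [directedEdges, Set.mem_ofPred_eq, Set.mem_union, Set.mem_inter_iff, delete_isLink]
  tauto

theorem dirichlet_delete_le (h : α → ℝ) : (N.delete S).dirichlet h ≤ N.dirichlet h :=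
  ENNReal.tsum_mono_subtype (N.edgeEnergy h)
    ((directedEdges_eq_union (N := N) (S := S)).symm ▸ Set.subset_union_left)

theorem dirichlet_le_delete_add (h : α → ℝ) : N.dirichlet h ≤ (N.delete S).dirichlet h +
    ∑' d : ↑(N.directedEdges ∩ {d | d.1 ∈ S}), N.edgeEnergy h d := by
  have h1 : N.dirichlet h = ∑' d : ↑((N.delete S).directedEdges ∪
      (N.directedEdges ∩ {d | d.1 ∈ S})), N.edgeEnergy h d := by
    rw [← directedEdges_eq_union]; rfl
  rw [h1]
  exact ENNReal.tsum_union_le _ _ _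

theorem tsum_link_le (N : Network α β) (e : β) (a : ℝ≥0∞) :
    ∑' _ : {p : α × α | N.graph.IsLink e p.1 p.2}, a ≤ 2 * a := by
  classical
  by_cases he : ∃ x y, N.graph.IsLink e x y
  · obtain ⟨x, y, hxy⟩ := he
    have hsub : {p : α × α | N.graph.IsLink e p.1 p.2} ⊆ (({(x, y), (y, x)} : Finset _) : Set _) := by
      rintro ⟨u, v⟩ (huv : N.graph.IsLink e u v)
      rcases huv.eq_and_eq_or_eq_and_eq hxy with ⟨rfl, rfl⟩ | ⟨rfl, rfl⟩ <;> simp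
    refine (ENNReal.tsum_mono_subtype (fun _ => a) hsub).trans ?_
    rw [Finset.tsum_subtype' _ (fun _ => a), Finset.sum_const, nsmul_eq_mul]
    gcongr
    exact_mod_cast Finset.card_le_two
  · have : IsEmpty {p : α × α | N.graph.IsLink e p.1 p.2} :=
      ⟨fun p => he ⟨_, _, p.2⟩⟩
    simp

theorem tsum_edgeEnergy_le (hS : S ⊆ E(N.graph)) {h : α → ℝ} {B : ℝ} (hB : ∀ x, |h x| ≤ B) :
    ∑' d : ↑(N.directedEdges ∩ {d | d.1 ∈ S}), N.edgeEnergy h d ≤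
      2 * (ENNReal.ofReal ((2 * B) ^ 2) * ∑' e : S, ENNReal.ofReal (1 / N.resistance e)) := by
  have hb : ∀ d : ↑(N.directedEdges ∩ {d | d.1 ∈ S}), N.edgeEnergy h d ≤
      ENNReal.ofReal ((2 * B) ^ 2 * (1 / N.resistance d.1.1)) := by
    intro d
    have hr : 0 < N.resistance d.1.1 := N.resistance_pos _ (hS d.2.2)
    refine ENNReal.ofReal_le_ofReal ?_
    rw [div_pow, Real.sq_sqrt hr.le, div_eq_mul_one_div]
    refine mul_le_mul_of_nonneg_right (sq_le_sq.2 ?_) (by positivity)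
    refine (abs_sub _ _).trans ((add_le_add (hB _) (hB _)).trans ?_)
    rw [← two_mul]
    exact le_abs_self _
  refine (ENNReal.tsum_le_tsum hb).trans ?_
  -- Grouping by the underlying edge leaves at most two directions for each edge of `S`.
  let j : ↑(N.directedEdges ∩ {d | d.1 ∈ S}) →
      (Σ e : S, {p : α × α | N.graph.IsLink e p.1 p.2}) :=
    fun d => ⟨⟨d.1.1, d.2.2⟩, ⟨d.1.2, d.2.1.1⟩⟩
  have hj : Function.Injective j := by
    rintro ⟨⟨e, p⟩, h1⟩ ⟨⟨e', p'⟩, h2⟩ h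
    simp only [j, Sigma.mk.injEq, Subtype.mk.injEq] at h
    obtain ⟨rfl, h⟩ := h
    have h' := eq_of_heq h
    rw [Subtype.mk.injEq] at h'
    subst h'
    rfl
  refine (ENNReal.tsum_comp_le_tsum_of_injective hj
    (fun q => ENNReal.ofReal ((2 * B) ^ 2 * (1 / N.resistance q.1)))).trans ?_
  rw [ENNReal.tsum_sigma', ← ENNReal.tsum_mul_left, ← ENNReal.tsum_mul_left]
  refine ENNReal.tsum_le_tsum fun e => ?_
  rw [← ENNReal.ofReal_mul (sq_nonneg _)]
  exact tsum_link_le N e _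

theorem Approximable.delete {f : α → ℝ}
    (hf : N.Approximable f) : (N.delete S).Approximable f := by
  obtain ⟨c, B, K, l, hK, hl, hev, hlim⟩ := hf
  exact ⟨c, B, K, l, hK, hl,
    hev.mono fun g hg => ⟨hg.1, (dirichlet_delete_le _).trans hg.2⟩,
    fun x hx => hlim x (vertexSet_delete_subset hx)⟩

theorem dirichlet_congr {f g : α → ℝ} (h : ∀ x ∈ V(N.graph), f x = g x) :
    N.dirichlet f = N.dirichlet g := by
  refine tsum_congr fun d => ?_
  rw [grad, grad, h _ d.2.1.left_mem, h _ d.2.1.right_mem]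

theorem Approximable.of_delete (hS : S ⊆ E(N.graph))
    (hsum : Summable (fun e : S => 1 / N.resistance e)) {f : α → ℝ} {M : ℝ}
    (hM : ∀ x, |f x| ≤ M) (hf : (N.delete S).Approximable f) : N.Approximable f := by
  classical
  obtain ⟨c, B, K, l, hK, hl, hev, hlim⟩ := hf
  let V' := V((N.delete S).graph)
  -- Approximants say nothing useful at vertices lost in the deletion. There the limit value `f x -
  -- c` is prescribed on a growing finite set; only edges of `S` meet these vertices, so boundedness
  -- alone controls the added energy.
  let F : (α →₀ ℝ) × Finset α → α → ℝ := fun q x =>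
    if x ∈ V' then q.1 x else if x ∈ q.2 then f x - c else 0
  have hF : ∀ q x, F q x ≠ 0 → x ∈ q.1.support ∪ q.2 := by
    intro q x hx
    rw [Finset.mem_union, Finsupp.mem_support_iff]
    simp only [F] at hx
    split_ifs at hx with h1 h2
    · exact Or.inl hx
    · exact Or.inr h2
    · exact (hx rfl).elim
  set C := max B (M + |c|) with hC
  refine ⟨c, C, K + 2 * (ENNReal.ofReal ((2 * C) ^ 2) *
      ∑' e : S, ENNReal.ofReal (1 / N.resistance e)),
    map (fun q => Finsupp.onFinset (q.1.support ∪ q.2) (F q) (hF q)) (l ×ˢ atTop), ?_,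
    inferInstance, ?_, ?_⟩
  · refine ENNReal.add_lt_top.2 ⟨hK, ENNReal.mul_lt_top (by simp)
      (ENNReal.mul_lt_top ENNReal.ofReal_lt_top ?_)⟩
    exact lt_top_iff_ne_top.2 hsum.tsum_ofReal_ne_top
  · rw [eventually_map]
    filter_upwards [tendsto_fst.eventually hev] with q hq
    have hb : ∀ x, |F q x| ≤ C := by
      intro x
      simp only [F]
      have hx : |f x - c| ≤ C :=
        (abs_sub _ _).trans ((add_le_add (hM x) le_rfl).trans (le_max_right _ _))
      split_ifs
      · exact (hq.1 x).trans (le_max_left _ _)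
      · exact hx
      · rw [abs_zero]
        exact (abs_nonneg _).trans hx
    refine ⟨hb, (dirichlet_le_delete_add _).trans (add_le_add ?_ (tsum_edgeEnergy_le hS hb))⟩
    refine le_of_eq_of_le (dirichlet_congr fun x hx => ?_) hq.2
    exact if_pos hx
  · intro x hx
    rw [tendsto_map'_iff]
    simp only [Function.comp_def, Finsupp.onFinset_apply, F]
    by_cases h : x ∈ V'
    · simp only [h, if_true]
      exact (hlim x h).comp tendsto_fst
    · simp only [h, if_false]
      refine tendsto_const_nhds.congr' ?_
      filter_upwards [tendsto_snd.eventually (eventually_ge_atTop {x})] with q hq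
      rw [if_pos (hq (Finset.mem_singleton_self x))]

end Network

theorem mainTheorem2 {α β : Type*} (N : Network α β)
    (hconn : N.graph.IsConnected) (hfin : N.graph.IsLocallyFinite)
    (S : Set β) (hS : S ⊆ E(N.graph))
    (hSconn : (N.delete S).graph.IsConnected)
    (hsum : Summable (fun e : S => 1 / N.resistance e)) :
    (N.delete S).InOHD ↔ N.InOHD := by
  have hfin' := Network.isLocallyFinite_delete (S := S) hfin
  constructor
  · intro hD
    refine Network.inOHD_of_approximable hconn hfin fun f B hB hf => ?_
    exact .of_delete hS hsum hB
      (hD.approximable hSconn hfin' hB ((Network.dirichlet_delete_le f).trans_lt hf))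
  · intro hN
    refine Network.inOHD_of_approximable hSconn hfin' fun f B hB hf => ?_
    refine (hN.approximable hconn hfin hB ?_).delete
    refine (Network.dirichlet_le_delete_add (S := S) f).trans_lt (ENNReal.add_lt_top.2 ⟨hf, ?_⟩)
    refine (Network.tsum_edgeEnergy_le hS hB).trans_lt (ENNReal.mul_lt_top (by simp)
      (ENNReal.mul_lt_top ENNReal.ofReal_lt_top ?_))
    exact lt_top_iff_ne_top.2 hsum.tsum_ofReal_ne_top
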